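/- Let $\mathbb{F}$ be a field of characteristic zero and let $L$ be a left Leibniz algebra over $\mathbb{F}$, that is, an $\mathbb{F}$-vector space (of arbitrary dimension) with a bilinear multiplication satisfying $x(yz)=(xy)z+y(xz)$ for all $x,y,z\in L$. Let $\mathrm{Leib}(L)$ be the linear span of all squares $x^2=xx$, $x\in L$; it is an ideal of $L$ and $L/\mathrm{Leib}(L)$ is a Lie algebra, the canonical Lie algebra of $L$. Call $L$ Lie-simple if $L/\mathrm{Leib}(L)$ is a simple Lie algebra. (A simple Lie algebra is non-abelian by definition, and completely reducible modules and bimodules are allowed to be zero.) Then the following statements are equivalent: (i) $L$ is finite-dimensional and Lie-simple. (ii) There exists a finite-dimensional simple Lie subalgebra $\mathfrak{g}$ of $L$ (a subalgebra that is a Lie algebra under the multiplication of $L$) such that $L=\mathfrak{g}\oplus\mathrm{Leib}(L)$ as vector spaces, and $\mathrm{Leib}(L)$, with left and right $\mathfrak{g}$-actions given by the multiplication of $L$, is a finite-dimensional completely reducible Leibniz $\mathfrak{g}$-bimodule that is anti-symmetric (its right action is zero) and does not contain any non-zero trivial $\mathfrak{g}$-subbimodule (a subbimodule on which both actions are zero).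 (iii) $L$ is isomorphic to the left hemi-semidirect product $\mathfrak{g}\ltimes_\ell M$ of a finite-dimensional simple Lie algebra $\mathfrak{g}$ over $\mathbb{F}$ and a finite-dimensional completely reducible left $\mathfrak{g}$-module $M$ that does not contain any non-zero trivial $\mathfrak{g}$-submodule. Here $\mathfrak{g}\ltimes_\ell M$ is the vector space $\mathfrak{g}\times M$ with the multiplication $(g,m)(g',m')=([g,g'],g\cdot m')$. -/

import Mathlib

universe u v

/-- A (not necessarily associative) ring satisfies the *left Leibniz identity* if every left
multiplication is a derivation. A left Leibniz algebra over a field `F` is an `F`-vector space `L`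
with an `F`-bilinear multiplication (`NonUnitalNonAssocRing L`, `Module F L`, `IsScalarTower F L L`,
`SMulCommClass F L L`) which satisfies `IsLeftLeibniz L`. -/
class IsLeftLeibniz (L : Type*) [NonUnitalNonAssocRing L] : Prop where
  leibniz : ∀ x y z : L, x * (y * z) = (x * y) * z + y * (x * z)

namespace LeibnizAlgebra

section Kernel

variable (F : Type*) (L : Type*) [Field F] [NonUnitalNonAssocRing L] [Module F L]

/-- The Leibniz kernel `Leib(L)`: the linear span of all squares. -/
def leib : Submodule F L := Submodule.span F (Set.range fun x : L => x * x)

variable {L}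

theorem sq_mem_leib (x : L) : x * x ∈ leib F L := Submodule.subset_span ⟨x, rfl⟩

variable [IsLeftLeibniz L]

theorem mul_mem_leib [SMulCommClass F L L] (x : L) {m : L} (hm : m ∈ leib F L) : x * m ∈ leib F L := by
  induction hm using Submodule.span_induction with
  | mem m hm =>
    obtain ⟨y, rfl⟩ := hm
    have h : x * (y * y) = (x * y + y) * (x * y + y) - (x * y) * (x * y) - y * y := by
      rw [IsLeftLeibniz.leibniz x y y, add_mul, mul_add, mul_add]
      abel
    change x * (y * y) ∈ leib F L
    rw [h]
    exact sub_mem (sub_mem (sq_mem_leib F _) (sq_mem_leib F _)) (sq_mem_leib F _)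
  | zero => rw [mul_zero]; exact zero_mem _
  | add a b _ _ ha hb => rw [mul_add]; exact add_mem ha hb
  | smul c a _ ha => rw [mul_smul_comm]; exact Submodule.smul_mem _ c ha

theorem leib_mul_eq_zero [IsScalarTower F L L] {m : L} (hm : m ∈ leib F L) (x : L) : m * x = 0 := by
  induction hm using Submodule.span_induction with
  | mem m hm =>
    obtain ⟨y, rfl⟩ := hm
    have h := IsLeftLeibniz.leibniz y y x
    change (y * y) * x = 0
    simpa using h
  | zero => rw [zero_mul]
  | add a b _ _ ha hb => rw [add_mul, ha, hb, add_zero]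
  | smul c a _ ha => rw [smul_mul_assoc, ha, smul_zero]

theorem leib_mul_mem [IsScalarTower F L L] {m : L} (hm : m ∈ leib F L) (x : L) : m * x ∈ leib F L := by
  rw [leib_mul_eq_zero F hm x]; exact zero_mem _

end Kernel

section Canonical

variable (F : Type*) (L : Type*) [Field F] [NonUnitalNonAssocRing L] [Module F L]

/-- The canonical Lie algebra `L_Lie = L / Leib(L)`. -/
abbrev CanonicalLie : Type _ := L ⧸ leib F L

variable [IsScalarTower F L L] [SMulCommClass F L L] [IsLeftLeibniz L]

/-- The multiplication of `L / Leib(L)` induced by the multiplication of `L`. -/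
def canonicalBracket : CanonicalLie F L →ₗ[F] CanonicalLie F L →ₗ[F] CanonicalLie F L :=
  (leib F L).liftQ
    (LinearMap.mk₂ F
      (fun (x : L) (y : CanonicalLie F L) =>
        (leib F L).mapQ (leib F L) (LinearMap.mulLeft F x) (fun _ hm => mul_mem_leib F x hm) y)
      (fun x x' y => by
        obtain ⟨y, rfl⟩ := (leib F L).mkQ_surjective y
        exact congrArg (leib F L).mkQ (add_mul x x' y))
      (fun c x y => by
        obtain ⟨y, rfl⟩ := (leib F L).mkQ_surjective y
        exact congrArg (leib F L).mkQ (smul_mul_assoc c x y))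
      (fun x y y' => map_add _ y y')
      (fun c x y => map_smul _ c y))
    (fun m hm => by
      rw [LinearMap.mem_ker]
      ext y
      exact congrArg (leib F L).mkQ (leib_mul_eq_zero F hm y))

theorem canonicalBracket_mk (x y : L) :
    canonicalBracket F L (Submodule.Quotient.mk x) (Submodule.Quotient.mk y) =
      Submodule.Quotient.mk (x * y) := rfl

instance : LieRing (CanonicalLie F L) where
  bracket x y := canonicalBracket F L x y
  add_lie x y z := LinearMap.map_add₂ (canonicalBracket F L) x y z
  lie_add x y z := map_add (canonicalBracket F L x) y z
  lie_self x := by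
    obtain ⟨x, rfl⟩ := (leib F L).mkQ_surjective x
    change canonicalBracket F L (Submodule.Quotient.mk x) (Submodule.Quotient.mk x) = 0
    rw [canonicalBracket_mk, Submodule.Quotient.mk_eq_zero]
    exact sq_mem_leib F x
  leibniz_lie x y z := by
    obtain ⟨x, rfl⟩ := (leib F L).mkQ_surjective x
    obtain ⟨y, rfl⟩ := (leib F L).mkQ_surjective y
    obtain ⟨z, rfl⟩ := (leib F L).mkQ_surjective z
    exact congrArg (Submodule.Quotient.mk (p := leib F L)) (IsLeftLeibniz.leibniz x y z)

instance : LieAlgebra F (CanonicalLie F L) where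
  lie_smul c x y := map_smul (canonicalBracket F L x) c y

theorem canonicalLie_mk_lie_mk (x y : L) :
    ⁅(Submodule.Quotient.mk x : CanonicalLie F L), (Submodule.Quotient.mk y : CanonicalLie F L)⁆ =
      Submodule.Quotient.mk (x * y) := rfl

/-- A left Leibniz algebra is *Lie-simple* if its canonical Lie algebra is simple. -/
def IsLieSimple : Prop := LieAlgebra.IsSimple F (CanonicalLie F L)

end Canonical

section Bimodule

/-- A Leibniz bimodule `M` over a left Leibniz algebra `A`: a left action `x · m = left x m` and a
right action `m · x = right x m`, both bilinear, satisfying the three compatibility conditions. -/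
structure Bimodule (F A M : Type*) [Field F] [NonUnitalNonAssocRing A] [Module F A]
    [AddCommGroup M] [Module F M] where
  /-- the left action -/
  left : A →ₗ[F] M →ₗ[F] M
  /-- the right action, `right x m = m · x` -/
  right : A →ₗ[F] M →ₗ[F] M
  /-- `(xy) · m = x · (y · m) - y · (x · m)` -/
  llm : ∀ (x y : A) (m : M), left (x * y) m = left x (left y m) - left y (left x m)
  /-- `(x · m) · y = x · (m · y) - m · (xy)` -/
  lml : ∀ (x y : A) (m : M), right y (left x m) = left x (right y m) - right (x * y) m
  /-- `(m · x) · y = m · (xy) - x · (m · y)` -/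
  mll : ∀ (x y : A) (m : M), right y (right x m) = right (x * y) m - left x (right y m)

namespace Bimodule

variable {F A M : Type*} [Field F] [NonUnitalNonAssocRing A] [Module F A]
  [AddCommGroup M] [Module F M]

/-- A subspace is a subbimodule if it is stable under the left and the right action. -/
def IsSubbimodule (B : Bimodule F A M) (N : Submodule F M) : Prop :=
  ∀ x : A, ∀ m ∈ N, B.left x m ∈ N ∧ B.right x m ∈ N

/-- Every subbimodule has a complementary subbimodule. The zero bimodule is allowed. -/
def IsCompletelyReducible (B : Bimodule F A M) : Prop :=
  ∀ N : Submodule F M, B.IsSubbimodule N → ∃ N' : Submodule F M, B.IsSubbimodule N' ∧ IsCompl N N'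

/-- The right action is zero. -/
def IsAntiSymmetric (B : Bimodule F A M) : Prop :=
  ∀ (x : A) (m : M), B.right x m = 0

/-- Every subbimodule on which both actions vanish is zero. -/
def HasNoNonzeroTrivialSubbimodule (B : Bimodule F A M) : Prop :=
  ∀ N : Submodule F M, B.IsSubbimodule N →
    (∀ x : A, ∀ m ∈ N, B.left x m = 0 ∧ B.right x m = 0) → N = ⊥

end Bimodule

end Bimodule

section Subalgebra

variable (F : Type*) (L : Type*) [Field F] [NonUnitalNonAssocRing L] [Module F L]

/-- A *Lie subalgebra* of a left Leibniz algebra `L`: a subalgebra that is a Lie algebra under the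
multiplication of `L`. Only `x x = 0` has to be required, as the Leibniz identity is inherited from
`L` and is the Jacobi identity for an alternating multiplication. -/
structure LieSubalg extends NonUnitalSubalgebra F L where
  mul_self_eq_zero : ∀ x ∈ carrier, x * x = 0

variable {F L}

/-- The underlying subspace of a Lie subalgebra. -/
def LieSubalg.toSubspace (g : LieSubalg F L) : Submodule F L := g.toNonUnitalSubalgebra.toSubmodule

instance : CoeSort (LieSubalg F L) (Type _) := ⟨fun g => g.toNonUnitalSubalgebra⟩

variable [IsScalarTower F L L] [SMulCommClass F L L] [IsLeftLeibniz L]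

/-- The Lie bracket of a Lie subalgebra is the multiplication of `L`. -/
instance (g : LieSubalg F L) : LieRing g where
  bracket x y := x * y
  add_lie x y z := add_mul x y z
  lie_add x y z := mul_add x y z
  lie_self x := Subtype.ext (g.mul_self_eq_zero x x.2)
  leibniz_lie x y z := Subtype.ext (IsLeftLeibniz.leibniz (x : L) y z)

instance (g : LieSubalg F L) : LieAlgebra F g where
  lie_smul c x y := Subtype.ext (mul_smul_comm c (x : L) (y : L))

theorem LieSubalg.coe_lie (g : LieSubalg F L) (x y : g) : ((⁅x, y⁆ : g) : L) = (x : L) * y := rfl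

/-- The Leibniz kernel of `L` as a bimodule over a Lie subalgebra `g`, both actions being given by
the multiplication of `L`. -/
def leibBimodule (g : LieSubalg F L) : Bimodule F g (leib F L) where
  left := LinearMap.mk₂ F (fun x m => ⟨(x : L) * m, mul_mem_leib F (x : L) m.2⟩)
    (fun x y m => Subtype.ext (add_mul (x : L) y m))
    (fun c x m => Subtype.ext (smul_mul_assoc c (x : L) (m : L)))
    (fun x m n => Subtype.ext (mul_add (x : L) m n))
    (fun c x m => Subtype.ext (mul_smul_comm c (x : L) (m : L)))
  right := LinearMap.mk₂ F (fun x m => ⟨(m : L) * x, leib_mul_mem F m.2 (x : L)⟩)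
    (fun x y m => Subtype.ext (mul_add (m : L) x y))
    (fun c x m => Subtype.ext (mul_smul_comm c (m : L) (x : L)))
    (fun x m n => Subtype.ext (add_mul (m : L) n x))
    (fun c x m => Subtype.ext (smul_mul_assoc c (m : L) (x : L)))
  llm x y m := Subtype.ext (eq_sub_of_add_eq (IsLeftLeibniz.leibniz (x : L) y m).symm)
  lml x y m := Subtype.ext (eq_sub_of_add_eq (IsLeftLeibniz.leibniz (x : L) m y).symm)
  mll x y m := Subtype.ext (eq_sub_of_add_eq (IsLeftLeibniz.leibniz (m : L) x y).symm)

end Subalgebra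

section HemiSemidirect

/-- The left hemi-semidirect product `𝔤 ⋉_ℓ M` of a Lie algebra and a left module: the vector space
`𝔤 × M` with the multiplication `(g, m) (g', m') = ([g, g'], g · m')`. -/
def HemiSemidirect (𝔤 M : Type*) : Type _ := 𝔤 × M

namespace HemiSemidirect

variable (F 𝔤 M : Type*) [Field F] [LieRing 𝔤] [LieAlgebra F 𝔤] [AddCommGroup M] [Module F M]
  [LieRingModule 𝔤 M] [LieModule F 𝔤 M]

instance : AddCommGroup (HemiSemidirect 𝔤 M) := inferInstanceAs (AddCommGroup (𝔤 × M))

instance : Module F (HemiSemidirect 𝔤 M) := inferInstanceAs (Module F (𝔤 × M))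

instance : Mul (HemiSemidirect 𝔤 M) := ⟨fun a b => (⁅a.1, b.1⁆, ⁅a.1, b.2⁆)⟩

instance : NonUnitalNonAssocRing (HemiSemidirect 𝔤 M) where
  left_distrib a b c := Prod.ext (lie_add a.1 b.1 c.1) (lie_add a.1 b.2 c.2)
  right_distrib a b c := Prod.ext (add_lie a.1 b.1 c.1) (add_lie a.1 b.1 c.2)
  zero_mul a := Prod.ext (zero_lie a.1) (zero_lie a.2)
  mul_zero a := Prod.ext (lie_zero a.1) (lie_zero a.1)

instance : IsScalarTower F (HemiSemidirect 𝔤 M) (HemiSemidirect 𝔤 M) where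
  smul_assoc c a b := Prod.ext (smul_lie c a.1 b.1) (smul_lie c a.1 b.2)

instance : SMulCommClass F (HemiSemidirect 𝔤 M) (HemiSemidirect 𝔤 M) where
  smul_comm c a b := Prod.ext (lie_smul c a.1 b.1).symm (lie_smul c a.1 b.2).symm

instance : IsLeftLeibniz (HemiSemidirect 𝔤 M) where
  leibniz a b c := Prod.ext (leibniz_lie a.1 b.1 c.1) (leibniz_lie a.1 b.1 c.2)

end HemiSemidirect

end HemiSemidirect

section LieModule

/-- A left module over a Lie algebra is completely reducible if every submodule has a complementary
submodule. The zero module is allowed. -/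
def IsCompletelyReducible (F 𝔤 M : Type*) [Field F] [LieRing 𝔤] [AddCommGroup M]
    [Module F M] [LieRingModule 𝔤 M] : Prop :=
  ComplementedLattice (LieSubmodule F 𝔤 M)

/-- Every submodule with zero action is zero. -/
def HasNoNonzeroTrivialSubmodule (F 𝔤 M : Type*) [Field F] [LieRing 𝔤] [AddCommGroup M]
    [Module F M] [LieRingModule 𝔤 M] : Prop :=
  ∀ N : LieSubmodule F 𝔤 M, LieModule.IsTrivial 𝔤 N → N = ⊥

end LieModule

end LeibnizAlgebra

open LeibnizAlgebra

/-! The point is that `Leib(L)` annihilates `L` from the left. For a linear section `s` of `L → L /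
Leib(L)`, the defect `s x * s y - s ⁅x, y⁆` is therefore a 1-cocycle in `x` with values in `Hom(L /
Leib(L), Leib(L))`. Whitehead's first lemma (`exists_eq_lie_of_isOneCocycle`) then yields a
multiplicative section; no second cohomology is needed. The same lemma gives Weyl's theorem, hence
complete reducibility of `Leib(L)`. If `L = 𝔤 ⊕ Leib(L)`, then `(a + m)(b + n) = ab + an`, which is
the hemi-semidirect product. In particular `(a + m)² = am`, so `Leib(L)` is spanned by `𝔤 ·
Leib(L)`, and a completely reducible module spanned in this way has no trivial summand. Conversely,
squares in `𝔤 ⋉_ℓ M` span `𝔤 · M`; a complement of this submodule is trivial, hence zero, so the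
Leibniz kernel is `M` and the quotient is `𝔤`. -/

namespace LieModule

/-! ### Invariance of the Casimir tensor. -/

section Invariance

variable {K L : Type*} [Field K] [LieRing L] [LieAlgebra K L]

/-- The canonical tensor `∑ xᵢ ⊗ xⁱ` of a nondegenerate invariant symmetric form is invariant. -/
theorem sum_dualBasis_invariant {ι : Type*} [Fintype ι] [DecidableEq ι]
    {Φ : LinearMap.BilinForm K L} (hΦ : Φ.Nondegenerate) (hs : Φ.IsSymm)
    (hinv : ∀ x y z : L, Φ ⁅x, y⁆ z = -Φ y ⁅x, z⁆) (b : Module.Basis ι K L)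
    {W : Type*} [AddCommGroup W] [Module K W] (β : L →ₗ[K] L →ₗ[K] W) (x : L) :
    ∑ i, (β ⁅x, b i⁆ (Φ.dualBasis hΦ b i) + β (b i) ⁅x, Φ.dualBasis hΦ b i⁆) = 0 := by
  set c := Φ.dualBasis hΦ b with hc
  have h1 (y : L) : y = ∑ j, Φ y (c j) • b j := by
    have h := (b.sum_repr y).symm
    have h2 (j) : b.repr y j = Φ y (c j) := by
      have := Φ.dualBasis_repr_apply hΦ c y j
      rw [hc, LinearMap.BilinForm.dualBasis_dualBasis hΦ hs] at this
      rw [this]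
    simpa only [h2] using h
  have h2 (y : L) : y = ∑ j, Φ y (b j) • c j := by
    have h := (c.sum_repr y).symm
    simpa only [hc, Φ.dualBasis_repr_apply hΦ b y] using h
  have e1 (i) : β ⁅x, b i⁆ (c i) = ∑ j, Φ ⁅x, b i⁆ (c j) • β (b j) (c i) := by
    conv_lhs => rw [h1 ⁅x, b i⁆]
    simp
  have e2 (i) : β (b i) ⁅x, c i⁆ = ∑ j, Φ ⁅x, c i⁆ (b j) • β (b i) (c j) := by
    conv_lhs => rw [h2 ⁅x, c i⁆]
    simp
  simp_rw [Finset.sum_add_distrib, e1, e2]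
  -- After the swap both sums run over the same `β (b j) (c i)`, with coefficients that are opposite
  -- by invariance of `Φ`.
  rw [Finset.sum_comm, ← Finset.sum_add_distrib]
  refine Finset.sum_eq_zero fun j _ => ?_
  rw [← Finset.sum_add_distrib]
  refine Finset.sum_eq_zero fun i _ => ?_
  rw [hinv x (b i) (c j), hs.eq, neg_smul]
  simp

end Invariance

/-! ### Whitehead's first lemma and Weyl's theorem for simple Lie algebras. -/

variable {K L : Type*} [Field K] [LieRing L] [LieAlgebra K L]
  {M : Type*} [AddCommGroup M] [Module K M] [LieRingModule L M] [LieModule K L M]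

/-- A linear map `d` from a Lie algebra to a module is a 1-cocycle if `d [x, y] = x d y - y d x`. -/
def IsOneCocycle (d : L →ₗ[K] M) : Prop := ∀ x y : L, d ⁅x, y⁆ = ⁅x, d y⁆ - ⁅y, d x⁆

variable [LieAlgebra.IsSimple K L]

theorem _root_.LieAlgebra.IsSimple.lie_top_top : ⁅(⊤ : LieIdeal K L), (⊤ : LieIdeal K L)⁆ = ⊤ := by
  refine (LieAlgebra.IsSimple.eq_bot_or_eq_top (R := K) _).resolve_left fun h => ?_
  refine LieAlgebra.IsSimple.non_abelian K (L := L) ⟨fun x y => ?_⟩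
  rw [← LieSubmodule.mem_bot (R := K) (L := L), ← h]
  exact LieSubmodule.lie_mem_lie (LieSubmodule.mem_top x) (LieSubmodule.mem_top y)

/-- A simple Lie algebra is spanned by brackets. -/
theorem _root_.LieAlgebra.IsSimple.span_lie_eq_top :
    Submodule.span K {z : L | ∃ x y : L, ⁅x, y⁆ = z} = ⊤ := by
  have h := congrArg LieSubmodule.toSubmodule (LieAlgebra.IsSimple.lie_top_top (K := K) (L := L))
  rw [LieSubmodule.lieIdeal_oper_eq_linear_span'] at h
  simpa using h

/-- The radical of an invariant form is an ideal, so by simplicity it is zero or everything. -/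
theorem traceForm_nondegenerate_of_ne_zero (h : traceForm K L M ≠ 0) :
    (traceForm K L M).Nondegenerate := by
  let I : LieIdeal K L :=
    { LinearMap.ker (traceForm K L M) with
      lie_mem := fun {x y} hy => by
        change y ∈ LinearMap.ker (traceForm K L M) at hy
        change ⁅x, y⁆ ∈ LinearMap.ker (traceForm K L M)
        rw [LinearMap.mem_ker] at hy ⊢
        ext z
        rw [traceForm_apply_lie_apply', hy]
        simp }
  have hI : I = ⊥ := by
    refine (LieAlgebra.IsSimple.eq_bot_or_eq_top (R := K) I).resolve_right fun hI => h ?_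
    refine LinearMap.ext fun x => ?_
    have : x ∈ I := hI ▸ LieSubmodule.mem_top x
    exact this
  refine (traceForm_isSymm K L M).isRefl.nondegenerate_iff_separatingLeft.mpr ?_
  rw [LinearMap.separatingLeft_iff_ker_eq_bot, eq_bot_iff]
  intro x hx
  have : x ∈ I := hx
  rw [hI] at this
  exact this

variable [CharZero K] [FiniteDimensional K M]

/-- Cartan's criterion makes `[L, L]` act nilpotently, and `[L, L] = L`. -/
theorem isNilpotent_of_traceForm_eq_zero (h : traceForm K L M = 0) : IsNilpotent L M := by
  have h1 := isNilpotent_derivedSeries_of_traceForm_eq_zero h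
  rw [isNilpotent_iff_forall' (R := K)] at h1 ⊢
  intro x
  refine h1 ⟨x, ?_⟩
  rw [LieAlgebra.derivedSeries_def, LieAlgebra.derivedSeriesOfIdeal_succ,
    LieAlgebra.derivedSeriesOfIdeal_zero, LieAlgebra.IsSimple.lie_top_top]
  exact LieSubmodule.mem_top x

theorem isTrivial_of_traceForm_eq_zero [IsIrreducible K L M] (h : traceForm K L M = 0) :
    IsTrivial L M := by
  have := isNilpotent_of_traceForm_eq_zero h
  have := nontrivial_of_isIrreducible K L M
  have h2 := nontrivial_max_triv_of_isNilpotent K L M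
  rw [isTrivial_iff_max_triv_eq_top K]
  exact LieSubmodule.eq_top_of_isIrreducible K L M _

variable [FiniteDimensional K L]

/-- If the trace form vanishes, the module is trivial and a cocycle kills `[L, L] = L`. Otherwise
the Casimir operator `C` of the trace form is invertible by Schur's argument, and a primitive of `C
∘ d` can be written down explicitly. -/
theorem exists_eq_lie_of_isIrreducible [IsIrreducible K L M] {d : L →ₗ[K] M}
    (hd : IsOneCocycle d) : ∃ m : M, ∀ x, d x = ⁅x, m⁆ := by
  classical
  by_cases htr : traceForm K L M = 0
  · have := isTrivial_of_traceForm_eq_zero htr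
    refine ⟨0, fun x => ?_⟩
    rw [lie_zero]
    have hle : Submodule.span K {z : L | ∃ x y : L, ⁅x, y⁆ = z} ≤ LinearMap.ker d := by
      rw [Submodule.span_le]
      rintro _ ⟨x, y, rfl⟩
      change d ⁅x, y⁆ = 0
      rw [hd x y, trivial_lie_zero, trivial_lie_zero, sub_zero]
    rw [LieAlgebra.IsSimple.span_lie_eq_top] at hle
    exact hle Submodule.mem_top
  have hn := traceForm_nondegenerate_of_ne_zero htr
  set Φ := traceForm K L M with hΦ
  let b := Module.finBasis K L
  let c := Φ.dualBasis hn b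
  have hs : Φ.IsSymm := ⟨traceForm_comm K L M⟩
  -- Used twice: with the product of endomorphisms, to see that `C` commutes with `L`, and with `(y,
  -- z) ↦ ⁅y, d z⁆`, to compute `⁅x, m₀⁆`.
  have inv {W : Type _} [AddCommGroup W] [Module K W] (β : L →ₗ[K] L →ₗ[K] W) (x : L) :=
    sum_dualBasis_invariant hn hs
      (fun x y z => traceForm_apply_lie_apply' K L M x y z) b β x
  let C : M →ₗ[K] M := ∑ i, (toEnd K L M (b i)) ∘ₗ (toEnd K L M (c i))
  have hC (m : M) : C m = ∑ i, ⁅b i, ⁅c i, m⁆⁆ := by simp [C]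
  have hCx (x : L) (m : M) : C ⁅x, m⁆ = ⁅x, C m⁆ := by
    have h := inv ((LinearMap.mul K (Module.End K M)).compl₁₂
      (toEnd K L M : L →ₗ[K] Module.End K M) (toEnd K L M : L →ₗ[K] Module.End K M)) x
    have h := congrArg (fun f : Module.End K M => f m) h
    simp only [LinearMap.compl₁₂_apply, LinearMap.sum_apply, LinearMap.add_apply,
      LinearMap.mul_apply', Module.End.mul_apply, LieHom.coe_toLinearMap, toEnd_apply_apply,
      LinearMap.zero_apply, lie_lie] at h
    rw [hC, hC, lie_sum, ← sub_eq_zero, ← neg_eq_zero, ← h, ← Finset.sum_sub_distrib,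
      ← Finset.sum_neg_distrib]
    refine Finset.sum_congr rfl fun i _ => ?_
    simp only [lie_sub, c]
    abel
  have hC0 : C ≠ 0 := by
    intro h0
    -- Each summand has trace `Φ (b i) (c i) = 1`, so the trace is `dim L`, nonzero in
    -- characteristic zero.
    have ht : LinearMap.trace K M C = (Module.finrank K L : K) := by
      simp only [C, map_sum]
      have h1 : ∀ i, LinearMap.trace K M ((toEnd K L M (b i)) ∘ₗ (toEnd K L M (c i))) = 1 := fun i => by
        rw [← traceForm_apply_apply, ← hΦ,
          Φ.apply_dualBasis_right hn hs, if_pos rfl]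
      simp [h1]
    rw [h0, map_zero, eq_comm, Nat.cast_eq_zero] at ht
    have := LieAlgebra.IsSimple.nontrivial K L
    exact Module.finrank_pos.ne' ht
  let N : LieSubmodule K L M :=
    { LinearMap.ker C with
      lie_mem := fun {x m} hm => by
        change m ∈ LinearMap.ker C at hm
        change ⁅x, m⁆ ∈ LinearMap.ker C
        rw [LinearMap.mem_ker] at hm ⊢
        rw [hCx, hm, lie_zero] }
  have hN : N = ⊥ := by
    refine (IsSimpleOrder.eq_bot_or_eq_top N).resolve_right fun hN => hC0 ?_
    ext1 m
    have : m ∈ N := hN ▸ LieSubmodule.mem_top m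
    exact this
  have hinj : Function.Injective C := by
    rw [← LinearMap.ker_eq_bot, eq_bot_iff]
    intro m hm
    have : m ∈ N := hm
    rw [hN] at this
    exact this
  let m₀ : M := ∑ i, ⁅b i, d (c i)⁆
  have hm₀ (x : L) : ⁅x, m₀⁆ = C (d x) := by
    have h := inv ((toEnd K L M : L →ₗ[K] M →ₗ[K] M).compl₂ d) x
    simp only [LinearMap.compl₂_apply, LieHom.coe_toLinearMap, toEnd_apply_apply, hd x,
      lie_lie, lie_sub] at h
    rw [hC, lie_sum, ← sub_eq_zero, ← h, ← Finset.sum_sub_distrib]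
    refine Finset.sum_congr rfl fun i _ => ?_
    simp only [c]
    abel
  obtain ⟨m, hm⟩ := (LinearMap.injective_iff_surjective.mp hinj) m₀
  exact ⟨m, fun x => hinj (by rw [hCx, hm, hm₀])⟩

/-- **Whitehead's first lemma** for a simple Lie algebra: every 1-cocycle with values in a
finite-dimensional module is a coboundary. -/
theorem exists_eq_lie_of_isOneCocycle {d : L →ₗ[K] M} (hd : IsOneCocycle d) :
    ∃ m : M, ∀ x, d x = ⁅x, m⁆ := by
  induction hn : Module.finrank K M using Nat.strong_induction_on generalizing M with
  | _ n ih =>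
  subst hn
  rcases subsingleton_or_nontrivial M with hM | hM
  · exact ⟨0, fun x => Subsingleton.elim _ _⟩
  by_cases hirr : IsIrreducible K L M
  · exact exists_eq_lie_of_isIrreducible hd
  obtain ⟨N, hN0, hN1⟩ : ∃ N : LieSubmodule K L M, N ≠ ⊥ ∧ N ≠ ⊤ := by
    by_contra! h
    exact hirr (IsIrreducible.mk fun N hN => h N hN)
  have hlt1 : Module.finrank K (M ⧸ N) < Module.finrank K M := by
    have h := N.toSubmodule.finrank_quotient_add_finrank
    have h0 : 0 < Module.finrank K N.toSubmodule := by
      have : Nontrivial N.toSubmodule :=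
        Submodule.nontrivial_iff_ne_bot.mpr fun h => hN0 (by simpa using h)
      exact Module.finrank_pos
    change Module.finrank K (M ⧸ N.toSubmodule) < _
    omega
  have hlt2 : Module.finrank K N < Module.finrank K M :=
    Submodule.finrank_lt (s := N.toSubmodule) fun h => hN1 (by simpa using h)
  -- Modulo `N` the cocycle is the coboundary of the class of some `v`; subtracting the coboundary
  -- of `v` leaves a cocycle with values in `N`.
  obtain ⟨q, hq⟩ := ih _ hlt1 (M := M ⧸ N) (d := N.toSubmodule.mkQ ∘ₗ d)
    (fun x y => congrArg N.toSubmodule.mkQ (hd x y)) rfl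
  obtain ⟨v, rfl⟩ := N.toSubmodule.mkQ_surjective q
  let d' : L →ₗ[K] M := d - ((toEnd K L M : L →ₗ[K] M →ₗ[K] M).flip v)
  have hd' (x : L) : d' x = d x - ⁅x, v⁆ := rfl
  obtain ⟨w, hw⟩ := ih _ hlt2 (M := N)
    (d := d'.codRestrict N.toSubmodule fun x => (Submodule.Quotient.eq _).mp (hq x))
    (fun x y => Subtype.ext (by
      change d' ⁅x, y⁆ = ⁅x, d' y⁆ - ⁅y, d' x⁆
      simp only [hd', hd x y, lie_sub, lie_lie]
      abel)) rfl
  refine ⟨v + w, fun x => ?_⟩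
  have h : d' x = ⁅x, (w : M)⁆ := congrArg Subtype.val (hw x)
  rw [lie_add, ← h, hd']
  abel

/-- **Weyl's theorem** for a simple Lie algebra: finite-dimensional modules are completely
reducible. -/
theorem complementedLattice_of_isSimple : ComplementedLattice (LieSubmodule K L M) where
  exists_isCompl N := by
    obtain ⟨p, hp⟩ : ∃ p : M →ₗ[K] N, ∀ n : N, p n = n := by
      obtain ⟨p, hp⟩ := N.toSubmodule.subtype.exists_leftInverse_of_injective
        N.toSubmodule.ker_subtype
      exact ⟨p, LinearMap.congr_fun hp⟩
    -- The linear projection `p` is the identity on `N`, so `⁅x, p⁆` vanishes on `N` and `x ↦ ⁅x,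
    -- p⁆` is a `V`-valued cocycle. If it is the coboundary of `f ∈ V`, then `p - f` is an
    -- equivariant projection onto `N`.
    let V : LieSubmodule K L (M →ₗ[K] N) :=
      { carrier := {f | ∀ n : N, f n = 0}
        add_mem' := fun hf hg n => by rw [LinearMap.add_apply, hf n, hg n, add_zero]
        zero_mem' := fun _ => rfl
        smul_mem' := fun c f hf n => by rw [LinearMap.smul_apply, hf n, smul_zero]
        lie_mem := fun {x f} hf n => by
          rw [LieHom.lie_apply, hf n, lie_zero, zero_sub, ← LieSubmodule.coe_bracket, hf ⁅x, n⁆,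
            neg_zero] }
    have hV (x : L) : ⁅x, p⁆ ∈ V := fun n => by
      rw [LieHom.lie_apply, ← LieSubmodule.coe_bracket, hp, hp, sub_self]
    let d₀ : L →ₗ[K] M →ₗ[K] N :=
      (toEnd K L (M →ₗ[K] N) : L →ₗ[K] (M →ₗ[K] N) →ₗ[K] (M →ₗ[K] N)).flip p
    let d : L →ₗ[K] V := d₀.codRestrict V.toSubmodule hV
    obtain ⟨f, hf⟩ := exists_eq_lie_of_isOneCocycle (d := d) fun x y => Subtype.ext <| by
      change ⁅⁅x, y⁆, p⁆ = ⁅x, ⁅y, p⁆⁆ - ⁅y, ⁅x, p⁆⁆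
      exact lie_lie x y p
    have hf (x : L) : ⁅x, p - f⁆ = 0 := by
      rw [lie_sub, sub_eq_zero]
      exact congrArg Subtype.val (hf x)
    let q : M →ₗ⁅K,L⁆ N :=
      { p - (f : M →ₗ[K] N) with
        map_lie' := fun {x m} => by
          have h := LinearMap.congr_fun (hf x) m
          rw [LieHom.lie_apply, LinearMap.zero_apply, sub_eq_zero] at h
          exact h.symm }
    refine ⟨q.ker, ?_⟩
    rw [← LieSubmodule.isCompl_toSubmodule, LieModuleHom.ker_toSubmodule]
    refine LinearMap.isCompl_of_proj fun n => ?_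
    change p n - f.1 n = n
    rw [hp, f.2 n, sub_zero]

end LieModule

theorem LieAlgebra.IsSimple.of_equiv {R L L' : Type*} [CommRing R] [LieRing L] [LieAlgebra R L]
    [LieRing L'] [LieAlgebra R L'] [LieAlgebra.IsSimple R L] (e : L ≃ₗ⁅R⁆ L') :
    LieAlgebra.IsSimple R L' where
  eq_bot_or_eq_top I := by
    rcases LieAlgebra.IsSimple.eq_bot_or_eq_top (LieIdeal.comap e.toLieHom I) with h | h
    · left
      rw [LieSubmodule.eq_bot_iff]
      intro x hx
      have hmem : e.symm x ∈ LieIdeal.comap e.toLieHom I := by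
        rw [LieIdeal.mem_comap]
        simpa using hx
      rw [h, LieSubmodule.mem_bot] at hmem
      simpa using congrArg e hmem
    · right
      rw [eq_top_iff]
      intro x _
      have hmem : e.symm x ∈ LieIdeal.comap e.toLieHom I := h ▸ LieSubmodule.mem_top _
      rw [LieIdeal.mem_comap] at hmem
      simpa using hmem
  non_abelian h := LieAlgebra.IsSimple.non_abelian R (L := L)
    ((lie_abelian_iff_equiv_lie_abelian e).mpr h)

namespace LeibnizAlgebra

variable {F L : Type*} [Field F] [NonUnitalNonAssocRing L] [Module F L]
  [IsScalarTower F L L] [SMulCommClass F L L] [IsLeftLeibniz L]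

/-! ### The Leibniz kernel as a module and as a bimodule. -/

section Actions

variable (F L)

/-- The action of the canonical Lie algebra on the Leibniz kernel by left multiplication. -/
def canonicalAction : CanonicalLie F L →ₗ[F] leib F L →ₗ[F] leib F L :=
  (leib F L).liftQ
    (LinearMap.mk₂ F (fun (x : L) (m : leib F L) => ⟨x * m, mul_mem_leib F x m.2⟩)
      (fun x y m => Subtype.ext (add_mul x y (m : L)))
      (fun c x m => Subtype.ext (smul_mul_assoc c x (m : L)))
      (fun x m n => Subtype.ext (mul_add x (m : L) n))
      (fun c x m => Subtype.ext (mul_smul_comm c x (m : L))))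
    (fun n hn => by
      rw [LinearMap.mem_ker]
      exact LinearMap.ext fun m => Subtype.ext (leib_mul_eq_zero F hn (m : L)))

instance : LieRingModule (CanonicalLie F L) (leib F L) where
  bracket x m := canonicalAction F L x m
  add_lie x y m := LinearMap.map_add₂ (canonicalAction F L) x y m
  lie_add x m n := map_add (canonicalAction F L x) m n
  leibniz_lie x y m := by
    obtain ⟨x, rfl⟩ := (leib F L).mkQ_surjective x
    obtain ⟨y, rfl⟩ := (leib F L).mkQ_surjective y
    exact Subtype.ext (IsLeftLeibniz.leibniz x y (m : L))

instance : LieModule F (CanonicalLie F L) (leib F L) where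
  smul_lie c x m := LinearMap.map_smul₂ (canonicalAction F L) c x m
  lie_smul c x m := map_smul (canonicalAction F L x) c m

variable {F L}

theorem coe_mk_lie (x : L) (m : leib F L) :
    ((⁅(Submodule.Quotient.mk x : CanonicalLie F L), m⁆ : leib F L) : L) = x * m := rfl

/-- A Lie subalgebra acts on the Leibniz kernel by left multiplication. -/
instance (g : LieSubalg F L) : LieRingModule g (leib F L) where
  bracket x m := (leibBimodule g).left x m
  add_lie x y m := LinearMap.map_add₂ (leibBimodule g).left x y m
  lie_add x m n := map_add ((leibBimodule g).left x) m n
  leibniz_lie x y m := Subtype.ext (IsLeftLeibniz.leibniz (x : L) y (m : L))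

instance (g : LieSubalg F L) : LieModule F g (leib F L) where
  smul_lie c x m := LinearMap.map_smul₂ (leibBimodule g).left c x m
  lie_smul c x m := map_smul ((leibBimodule g).left x) c m

theorem leibBimodule_isAntiSymmetric (g : LieSubalg F L) : (leibBimodule g).IsAntiSymmetric :=
  fun x m => Subtype.ext (leib_mul_eq_zero F m.2 (x : L))

/-- Subbimodules of the Leibniz kernel are the same as Lie submodules. -/
theorem isSubbimodule_leibBimodule_iff (g : LieSubalg F L) (N : Submodule F (leib F L)) :
    (leibBimodule g).IsSubbimodule N ↔ ∀ x : g, ∀ m ∈ N, ⁅x, m⁆ ∈ N := by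
  refine ⟨fun h x m hm => (h x m hm).1, fun h x m hm => ⟨h x m hm, ?_⟩⟩
  rw [leibBimodule_isAntiSymmetric g x m]
  exact zero_mem N

theorem leibBimodule_isCompletelyReducible_iff (g : LieSubalg F L) :
    (leibBimodule g).IsCompletelyReducible ↔ IsCompletelyReducible F g (leib F L) := by
  constructor
  · intro h
    refine ⟨fun N => ?_⟩
    obtain ⟨N', hN', hc⟩ := h N.toSubmodule
      ((isSubbimodule_leibBimodule_iff g _).mpr fun x m hm => N.lie_mem hm)
    refine ⟨{ N' with
      lie_mem := fun {x m} hm => (isSubbimodule_leibBimodule_iff g _).mp hN' x m hm }, ?_⟩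
    rw [← LieSubmodule.isCompl_toSubmodule]
    exact hc
  · intro h N hN
    have : ComplementedLattice (LieSubmodule F g (leib F L)) := h
    let P : LieSubmodule F g (leib F L) := { N with
      lie_mem := fun {x m} hm => (isSubbimodule_leibBimodule_iff g _).mp hN x m hm }
    obtain ⟨Q, hQ⟩ := exists_isCompl P
    refine ⟨Q.toSubmodule, (isSubbimodule_leibBimodule_iff g _).mpr fun x m hm => Q.lie_mem hm, ?_⟩
    rw [← LieSubmodule.isCompl_toSubmodule] at hQ
    exact hQ

theorem leibBimodule_hasNoNonzeroTrivialSubbimodule_iff (g : LieSubalg F L) :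
    (leibBimodule g).HasNoNonzeroTrivialSubbimodule ↔
      HasNoNonzeroTrivialSubmodule F g (leib F L) := by
  constructor
  · intro h N hN
    rw [← LieSubmodule.toSubmodule_eq_bot]
    refine h N.toSubmodule
      ((isSubbimodule_leibBimodule_iff g _).mpr fun x m hm => N.lie_mem hm) fun x m hm =>
      ⟨congrArg Subtype.val (hN.trivial x ⟨m, hm⟩), leibBimodule_isAntiSymmetric g x m⟩
  · intro h N hN h0
    let P : LieSubmodule F g (leib F L) := { N with
      lie_mem := fun {x m} hm => (isSubbimodule_leibBimodule_iff g _).mp hN x m hm }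
    have hP : P = ⊥ := h P ⟨fun x m => Subtype.ext (h0 x m m.2).1⟩
    rw [← LieSubmodule.toSubmodule_eq_bot] at hP
    exact hP

end Actions

/-! ### Splitting off the canonical Lie algebra. -/

section Levi

/-- The **Levi splitting**: if the canonical Lie algebra is simple, the projection `L → L / Leib(L)`
has a multiplicative linear section. -/
theorem exists_multiplicative_section [CharZero F] [FiniteDimensional F L] (hL : IsLieSimple F L) :
    ∃ s : CanonicalLie F L →ₗ[F] L, (∀ x, Submodule.Quotient.mk (s x) = x) ∧
      ∀ x y, s x * s y = s ⁅x, y⁆ := by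
  have : LieAlgebra.IsSimple F (CanonicalLie F L) := hL
  obtain ⟨s, hs⟩ := (leib F L).mkQ.exists_rightInverse_of_surjective (leib F L).range_mkQ
  replace hs (x : CanonicalLie F L) : (Submodule.Quotient.mk (s x) : CanonicalLie F L) = x :=
    LinearMap.congr_fun hs x
  have hmem (x y : CanonicalLie F L) : s x * s y - s ⁅x, y⁆ ∈ leib F L := by
    rw [← Submodule.Quotient.mk_eq_zero, Submodule.Quotient.mk_sub, hs, ← canonicalLie_mk_lie_mk,
      hs, hs, sub_self]
  have hact (x : CanonicalLie F L) (m : leib F L) : ((⁅x, m⁆ : leib F L) : L) = s x * m := by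
    rw [← coe_mk_lie, hs]
  let d : CanonicalLie F L →ₗ[F] CanonicalLie F L →ₗ[F] leib F L :=
    LinearMap.mk₂ F (fun x y => ⟨s x * s y - s ⁅x, y⁆, hmem x y⟩)
      (fun x y z => Subtype.ext (by simp only [map_add, add_mul, add_lie, Submodule.coe_add]; abel))
      (fun c x y => Subtype.ext (by
        simp only [map_smul, smul_mul_assoc, smul_lie, Submodule.coe_smul, smul_sub]))
      (fun x y z => Subtype.ext (by simp only [map_add, mul_add, lie_add, Submodule.coe_add]; abel))
      (fun c x y => Subtype.ext (by
        simp only [map_smul, mul_smul_comm, lie_smul, Submodule.coe_smul, smul_sub]))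
  have hd (x y : CanonicalLie F L) : (d x y : L) = s x * s y - s ⁅x, y⁆ := rfl
  have hcoc : LieModule.IsOneCocycle d := by
    intro x y
    refine LinearMap.ext fun z => Subtype.ext ?_
    simp only [LinearMap.sub_apply, LieHom.lie_apply, Submodule.coe_sub, hact, hd, mul_sub]
    -- The two left factors differ by an element of `Leib(L)`, which annihilates from the left.
    have h1 : (s x * s y) * s z = s ⁅x, y⁆ * s z := by
      rw [← sub_eq_zero, ← sub_mul, leib_mul_eq_zero F (hmem x y)]
    rw [IsLeftLeibniz.leibniz (s x) (s y) (s z), h1, lie_lie x y z, map_sub]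
    abel
  obtain ⟨h, hh⟩ := LieModule.exists_eq_lie_of_isOneCocycle hcoc
  -- In the product of corrected values, `h x` on the left contributes nothing; what remains, `s x *
  -- s y - s x * h y`, is `s ⁅x, y⁆ - h ⁅x, y⁆` because `d x = ⁅x, h⁆`.
  refine ⟨s - (leib F L).subtype ∘ₗ h, fun x => ?_, fun x y => ?_⟩
  · rw [LinearMap.sub_apply, Submodule.Quotient.mk_sub, hs, sub_eq_self,
      Submodule.Quotient.mk_eq_zero]
    exact (h x).2
  · have e := congrArg Subtype.val (LinearMap.congr_fun (hh x) y)
    simp only [LieHom.lie_apply, Submodule.coe_sub, hact, hd] at e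
    simp only [LinearMap.sub_apply, LinearMap.comp_apply, Submodule.subtype_apply, sub_mul, mul_sub,
      leib_mul_eq_zero F (h x).2, sub_zero]
    rw [sub_eq_sub_iff_add_eq_add] at e ⊢
    rw [add_comm, ← sub_eq_zero] at e
    rw [← sub_eq_zero, ← e]
    abel

end Levi

/-! ### Consequences of a decomposition `L = g ⊕ Leib(L)`. -/

section Complement

/-- If `L = g ⊕ Leib(L)` then `Leib(L)` is spanned by the products of `g` with `Leib(L)`. -/
theorem eq_top_of_forall_lie_mem {g : LieSubalg F L} (hg : IsCompl g.toSubspace (leib F L))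
    {N : Submodule F (leib F L)} (hN : ∀ (x : g) (m : leib F L), ⁅x, m⁆ ∈ N) : N = ⊤ := by
  have hle : leib F L ≤ N.map (leib F L).subtype := by
    refine Submodule.span_le.mpr ?_
    rintro _ ⟨x, rfl⟩
    obtain ⟨a, ha, m, hm, rfl⟩ := Submodule.mem_sup.mp
      (hg.sup_eq_top ▸ Submodule.mem_top : x ∈ g.toSubspace ⊔ leib F L)
    refine ⟨⁅(⟨a, ha⟩ : g), (⟨m, hm⟩ : leib F L)⁆, hN _ _, ?_⟩
    change a * m = (a + m) * (a + m)
    rw [add_mul, leib_mul_eq_zero F hm, add_zero, mul_add, g.mul_self_eq_zero a ha, zero_add]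
  rw [eq_top_iff]
  intro m _
  obtain ⟨n, hn, h⟩ := hle m.2
  rwa [← Subtype.ext h]

/-- A complement of a trivial submodule contains every product of `g` with `Leib(L)`, hence is
everything. -/
theorem hasNoNonzeroTrivialSubmodule_leib {g : LieSubalg F L}
    (hg : IsCompl g.toSubspace (leib F L)) (hcr : IsCompletelyReducible F g (leib F L)) :
    HasNoNonzeroTrivialSubmodule F g (leib F L) := by
  intro N hN
  have : ComplementedLattice (LieSubmodule F g (leib F L)) := hcr
  obtain ⟨N', hN'⟩ := exists_isCompl N
  have htop : N' = ⊤ := by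
    rw [← LieSubmodule.toSubmodule_eq_top]
    refine eq_top_of_forall_lie_mem hg fun x m => ?_
    obtain ⟨n, hn, n', hn', rfl⟩ := (LieSubmodule.mem_sup _ _ _).mp
      (hN'.sup_eq_top ▸ LieSubmodule.mem_top m : m ∈ N ⊔ N')
    have h0 : ⁅x, n⁆ = 0 := congrArg Subtype.val (hN.trivial x ⟨n, hn⟩)
    rw [lie_add, h0, zero_add]
    exact N'.lie_mem hn'
  rw [htop] at hN'
  simpa using hN'.inf_eq_bot

/-- A Levi complement: the image of a multiplicative section of `L → L / Leib(L)`. -/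
theorem exists_lieSubalg_isCompl_leib [CharZero F] [FiniteDimensional F L]
    (hL : IsLieSimple F L) :
    ∃ g : LieSubalg F L, LieAlgebra.IsSimple F g ∧ IsCompl g.toSubspace (leib F L) := by
  have : LieAlgebra.IsSimple F (CanonicalLie F L) := hL
  obtain ⟨s, hs, hmul⟩ := exists_multiplicative_section hL
  obtain ⟨g, hg⟩ : ∃ g : LieSubalg F L, g.toSubspace = LinearMap.range s :=
    ⟨{ LinearMap.range s with
        mul_mem' := by
          rintro _ _ ⟨x, rfl⟩ ⟨y, rfl⟩
          exact ⟨⁅x, y⁆, (hmul x y).symm⟩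
        mul_self_eq_zero := by
          rintro _ ⟨x, rfl⟩
          rw [hmul, lie_self, map_zero] }, rfl⟩
  have hinj : Function.Injective s := fun x y h => by rw [← hs x, h, hs]
  let e : CanonicalLie F L ≃ₗ⁅F⁆ g :=
    { (LinearEquiv.ofInjective s hinj).trans (LinearEquiv.ofEq _ g.toSubspace hg.symm) with
      map_lie' := fun {x y} => Subtype.ext (hmul x y).symm }
  refine ⟨g, .of_equiv e, ?_⟩
  rw [hg]
  constructor
  · rw [Submodule.disjoint_def]
    rintro _ ⟨x, rfl⟩ hx
    rw [← Submodule.Quotient.mk_eq_zero, hs] at hx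
    rw [hx, map_zero]
  · rw [codisjoint_iff, eq_top_iff]
    intro x _
    refine Submodule.mem_sup.mpr ⟨s (Submodule.Quotient.mk x), ⟨_, rfl⟩,
      x - s (Submodule.Quotient.mk x), ?_, add_sub_cancel _ _⟩
    rw [← Submodule.Quotient.mk_eq_zero, Submodule.Quotient.mk_sub, hs, sub_self]

/-- If `L = g ⊕ Leib(L)` then `L` is the hemi-semidirect product of `g` and `Leib(L)`. -/
theorem exists_equiv_hemiSemidirect {g : LieSubalg F L} (hg : IsCompl g.toSubspace (leib F L)) :
    ∃ e : L ≃ₗ[F] HemiSemidirect g (leib F L), ∀ x y : L, e (x * y) = e x * e y := by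
  let e : HemiSemidirect g (leib F L) ≃ₗ[F] L := Submodule.prodEquivOfIsCompl _ _ hg
  have he (a : HemiSemidirect g (leib F L)) : e a = (a.1 : L) + a.2 := rfl
  have hmul (a b : HemiSemidirect g (leib F L)) : e (a * b) = e a * e b := by
    have h : e (a * b) = (a.1 : L) * b.1 + (a.1 : L) * b.2 := rfl
    rw [h, he, he, add_mul, leib_mul_eq_zero F a.2.2, add_zero, mul_add]
  exact ⟨e.symm, fun x y => e.injective (by simp [hmul])⟩

end Complement

/-! ### The Leibniz kernel and canonical Lie algebra of a hemi-semidirect product. -/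

section HemiSemidirect

variable {𝔤 M : Type*} [LieRing 𝔤] [LieAlgebra F 𝔤] [AddCommGroup M] [Module F M]
  [LieRingModule 𝔤 M] [LieModule F 𝔤 M]

/-- The Leibniz kernel of `𝔤 ⋉_ℓ M` is `M` if `M` is completely reducible without trivial
submodules. -/
theorem mem_leib_iff_of_equiv_hemiSemidirect (hcr : IsCompletelyReducible F 𝔤 M)
    (htr : HasNoNonzeroTrivialSubmodule F 𝔤 M) (e : L ≃ₗ[F] HemiSemidirect 𝔤 M)
    (he : ∀ x y : L, e (x * y) = e x * e y) (x : L) : x ∈ leib F L ↔ (e x).1 = 0 := by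
  have he' (a b : HemiSemidirect 𝔤 M) : e.symm (a * b) = e.symm a * e.symm b :=
    e.injective (by simp [he])
  let ι : M →ₗ[F] L := e.symm.toLinearMap ∘ₗ (LinearMap.inr F 𝔤 M : M →ₗ[F] 𝔤 × M)
  have hlie (y : 𝔤) (m : M) : ι ⁅y, m⁆ ∈ leib F L := by
    -- The square of `(y, m)` is `(0, ⁅y, m⁆)`.
    let a : HemiSemidirect 𝔤 M := (y, m)
    have h : ι ⁅y, m⁆ = e.symm (a * a) := congrArg e.symm (Prod.ext (lie_self y).symm rfl)
    rw [h, he']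
    exact sq_mem_leib F _
  let N : LieSubmodule F 𝔤 M := { (leib F L).comap ι with lie_mem := fun {y m} _ => hlie y m }
  have : ComplementedLattice (LieSubmodule F 𝔤 M) := hcr
  obtain ⟨N', hN'⟩ := exists_isCompl N
  -- `N` contains all of `𝔤 · M`, so the action on `N'` lands in `N ⊓ N' = ⊥`.
  have hbot : N' = ⊥ := htr N' ⟨fun y m => Subtype.ext (by
    have h : ⁅y, (m : M)⁆ ∈ N ⊓ N' := LieSubmodule.mem_inf _ _ _ |>.mpr
      ⟨hlie y m, N'.lie_mem m.2⟩
    rwa [hN'.inf_eq_bot] at h)⟩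
  have htop : N = ⊤ := by simpa [hbot] using hN'.sup_eq_top
  constructor
  · intro hx
    have hle : leib F L ≤ LinearMap.ker ((LinearMap.fst F 𝔤 M : 𝔤 × M →ₗ[F] 𝔤) ∘ₗ
        (e.toLinearMap : L →ₗ[F] 𝔤 × M)) := by
      refine Submodule.span_le.mpr ?_
      rintro _ ⟨y, rfl⟩
      change (e (y * y)).1 = 0
      rw [he]
      exact lie_self (e y).1
    exact hle hx
  · intro hx
    have h : (e x).2 ∈ N := htop ▸ LieSubmodule.mem_top _
    have h' : ι (e x).2 = x :=
      e.symm_apply_eq.mpr (Prod.ext hx.symm rfl)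
    rw [← h']
    exact h

theorem isLieSimple_of_equiv_hemiSemidirect [LieAlgebra.IsSimple F 𝔤]
    (hcr : IsCompletelyReducible F 𝔤 M) (htr : HasNoNonzeroTrivialSubmodule F 𝔤 M)
    (e : L ≃ₗ[F] HemiSemidirect 𝔤 M) (he : ∀ x y : L, e (x * y) = e x * e y) :
    IsLieSimple F L := by
  let π : L →ₗ[F] 𝔤 := (LinearMap.fst F 𝔤 M : 𝔤 × M →ₗ[F] 𝔤) ∘ₗ
    (e.toLinearMap : L →ₗ[F] 𝔤 × M)
  have hker : leib F L = LinearMap.ker π :=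
    Submodule.ext fun x => mem_leib_iff_of_equiv_hemiSemidirect hcr htr e he x
  have hsurj : Function.Surjective π := fun y => ⟨e.symm ((y, 0) : 𝔤 × M),
    congrArg Prod.fst (e.apply_symm_apply ((y, 0) : 𝔤 × M))⟩
  let E : CanonicalLie F L ≃ₗ[F] 𝔤 :=
    (Submodule.quotEquivOfEq _ _ hker).trans (π.quotKerEquivOfSurjective hsurj)
  have hE (x : L) : E (Submodule.Quotient.mk x) = (e x).1 := rfl
  let E' : CanonicalLie F L ≃ₗ⁅F⁆ 𝔤 :=
    { E with
      map_lie' := fun {x y} => by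
        obtain ⟨x, rfl⟩ := (leib F L).mkQ_surjective x
        obtain ⟨y, rfl⟩ := (leib F L).mkQ_surjective y
        change (e (x * y)).1 = ⁅(e x).1, (e y).1⁆
        rw [he]
        rfl }
  exact .of_equiv E'.symm

end HemiSemidirect

end LeibnizAlgebra

/-! ### The equivalence. -/

theorem theorem3p2 {F : Type v} {L : Type u} [Field F] [CharZero F]
    [NonUnitalNonAssocRing L] [Module F L] [IsScalarTower F L L] [SMulCommClass F L L]
    [IsLeftLeibniz L] :
    List.TFAE [
      FiniteDimensional F L ∧ IsLieSimple F L,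
      ∃ g : LieSubalg F L,
        FiniteDimensional F g ∧ LieAlgebra.IsSimple F g ∧
        IsCompl g.toSubspace (leib F L) ∧
        FiniteDimensional F (leib F L) ∧
        (leibBimodule g).IsCompletelyReducible ∧
        (leibBimodule g).IsAntiSymmetric ∧
        (leibBimodule g).HasNoNonzeroTrivialSubbimodule,
      ∃ (𝔤 : Type u) (_ : LieRing 𝔤) (_ : LieAlgebra F 𝔤)
        (M : Type u) (_ : AddCommGroup M) (_ : Module F M)
        (_ : LieRingModule 𝔤 M) (_ : LieModule F 𝔤 M),
        FiniteDimensional F 𝔤 ∧ LieAlgebra.IsSimple F 𝔤 ∧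
        FiniteDimensional F M ∧ LeibnizAlgebra.IsCompletelyReducible F 𝔤 M ∧
        HasNoNonzeroTrivialSubmodule F 𝔤 M ∧
        ∃ e : L ≃ₗ[F] HemiSemidirect 𝔤 M, ∀ x y : L, e (x * y) = e x * e y] := by
  tfae_have 1 → 2 := by
    rintro ⟨hfin, hL⟩
    obtain ⟨g, hg, hc⟩ := exists_lieSubalg_isCompl_leib hL
    have : FiniteDimensional F g := inferInstanceAs (FiniteDimensional F g.toSubspace)
    have hcr : LeibnizAlgebra.IsCompletelyReducible F g (leib F L) :=
      LieModule.complementedLattice_of_isSimple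
    exact ⟨g, this, hg, hc, inferInstance, (leibBimodule_isCompletelyReducible_iff g).mpr hcr,
      leibBimodule_isAntiSymmetric g, (leibBimodule_hasNoNonzeroTrivialSubbimodule_iff g).mpr
        (hasNoNonzeroTrivialSubmodule_leib hc hcr)⟩
  tfae_have 2 → 3 := by
    rintro ⟨g, hfin, hg, hc, hfin', hcr, -, htr⟩
    -- Both witnesses are subspaces of `L`, so they lie in its universe `u`.
    exact ⟨g, inferInstance, inferInstance, leib F L, inferInstance, inferInstance, inferInstance,
      inferInstance, hfin, hg, hfin', (leibBimodule_isCompletelyReducible_iff g).mp hcr,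
      (leibBimodule_hasNoNonzeroTrivialSubbimodule_iff g).mp htr, exists_equiv_hemiSemidirect hc⟩
  tfae_have 3 → 1 := by
    rintro ⟨𝔤, _, _, M, _, _, _, _, hfin, hg, hfin', hcr, htr, e, he⟩
    have : FiniteDimensional F (HemiSemidirect 𝔤 M) :=
      inferInstanceAs (FiniteDimensional F (𝔤 × M))
    exact ⟨e.symm.finiteDimensional, isLieSimple_of_equiv_hemiSemidirect hcr htr e he⟩
  tfae_finish
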